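/- **Setting.** Let $\Sigma$ be a finite vocabulary with predicate symbols $\Sigma_P$ and function symbols $\Sigma_F$. A *core ASP program* over $\Sigma$ is a finite set $\Pi$ of choice rules $\{A\}\leftarrow B_1,\dots,B_n,\mathtt{not}\,C_1,\dots,\mathtt{not}\,C_m$, normal rules $A\leftarrow B_1,\dots,\mathtt{not}\,C_m$ and constraints $\leftarrow B_1,\dots,\mathtt{not}\,C_m$, where $A$ is an atom $P(\bar t)$ with $P\in\Sigma_P$ and the $B_i$, $C_j$ are such atoms or equations $s=t$. Let $hd(\Pi)$ be the set of predicates occurring in rule heads. A predicate $P$ *positively depends* on $Q$ if there is a path of non-zero length from $P$ to $Q$ in the graph with an edge $P'\to Q'$ whenever some rule has $P'$ in its head and $Q'$ in a non-negated body atom. **Answer sets.** Map normal rules to $\forall\bar x(body\Rightarrow A)$, choice rules to $\forall\bar x(\neg\neg A\wedge body\Rightarrow A)$, constraints to $\neg\exists\bar x\,body$, and let $\tilde\Pi$ be the conjunction of these sentences. For a set $\mathbf p$ of predicates let $SM_{\mathbf p}(F)=F\wedge\neg\exists\mathbf u\,(\mathbf u<\mathbf p\wedge F^*(\mathbf u))$,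 where $F^*$ replaces each atom $P(\bar t)$ with $P\in\mathbf p$ by $u_P(\bar t)$, replaces $G\Rightarrow H$ by $(G^*\Rightarrow H^*)\wedge(G\Rightarrow H)$ (with $\neg G$ read as $G\Rightarrow\bot$), and commutes with all other constructs. An interpretation $\mathcal M$ (a $\Sigma$-structure with non-empty domain) is an *answer set* of $\Pi$ if it is a Herbrand interpretation and $\mathcal M\models SM_{\Sigma_P}(\tilde\Pi)$. Herbrand interpretations are those whose domain consists of the ground terms of $\Sigma$, each denoting itself, up to identification of ground terms with their values. **Splittings.** A partition $\{\Pi_1,\dots,\Pi_n\}$ of $\Pi$ into non-empty parts is a *splitting* if every part containing a constraint is a singleton, all rules with the same head predicate are in the same part, and the rules of two predicates that positively depend on each other are in the same part. It is *proper* if no part contains choice rules for two different predicates, no part contains both a normal and a choice rule, and no head predicate of a choice rule positively depends on itself. **Modules.** Below, $body$ is $B_1\wedge\dots\wedge B_n\wedge\neg C_1\wedge\dots\wedge\neg C_m$. * A G-module is a finite set of choice rules $\forall\bar y(\{P(\bar t)\}\leftarrow\varphi)$ with one common head predicate $P$; $\mathcal M$ is a model of it if for each $\bar d\in P^{\mathcal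 M}$ there are a rule of the module and values $\bar d'$ of $\bar y$ such that $\bar t$ takes the value $\bar d$ and $\varphi$ is true in $\mathcal M$ under $\bar y:\bar d'$. * A D-module $(Def,R)$ consists of a finite set $Def$ of predicates and a finite set $R$ of define rules $\forall\bar x(P(\bar t)\leftarrow\varphi)$ with $P\in Def$. $\mathcal M$ is a model of it if $\mathcal M|_{Def}$ is the least interpretation $\mathfrak A$ of $Def$ such that, with all other symbols interpreted as in $\mathcal M$, the pair $(\mathfrak A,\mathcal M|_{Def})$ satisfies every rule of $R$, where positive occurrences of atoms in $\varphi$ and the heads are evaluated in the first component, and negative occurrences in the second. * A T-module is a first-order sentence, with the classical semantics. * The Herbrand module $\mathcal H(\Sigma_F)$ has as its models the Herbrand interpretations. An ASP-FO theory is a finite set of modules; $\mathcal M$ is a model of it iff it is a model of each of its modules. For a part $\Pi_i$ of a proper splitting, $\widehat\Pi_i$ is the G-module of the rules $\forall\bar x(\{A\}\leftarrow body)$ if $\Pi_i$ consists of choice rules, the D-module $(hd(\Pi_i),\{\forall\bar x(A\leftarrow body)\})$ if it consists of normal rules, and the T-module $\forall\bar x\,\neg body$ if it consists of a constraint. **Theorem.**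 Let $\Pi$ be a core ASP program over a finite vocabulary $\Sigma$ with a proper splitting $\{\Pi_1,\dots,\Pi_n\}$. Then an interpretation $\mathcal M$ is an answer set of $\Pi$ if and only if $\mathcal M$ is a model of the ASP-FO theory $\{\mathcal H(\Sigma_F),\widehat\Pi_1,\dots,\widehat\Pi_n,(Def,\{\})\}$, where $Def=\Sigma_P\setminus hd(\Pi)$. -/

import Mathlib

universe u v w

namespace ASPFO

/-! ### Syntax of first-order logic

Vocabularies are first-order languages `L`, terms are Mathlib's terms with variables from `ℕ`.
Formulas are defined here with `⊥, ∧, ∨, →, ∀, ∃` all primitive, since the stable model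
operator is sensitive to the choice of connectives. -/

/-- Predicate symbols of the vocabulary, bundled with their arity. -/
abbrev Pred (L : FirstOrder.Language.{u, v}) : Type v := Σ n : ℕ, L.Relations n

/-- Function symbols of the vocabulary, bundled with their arity. -/
abbrev Fun (L : FirstOrder.Language.{u, v}) : Type u := Σ n : ℕ, L.Functions n

/-- An atom `P(t₁, …, tₙ)`. -/
structure Atom (L : FirstOrder.Language.{u, v}) where
  pred : Pred L
  args : Fin pred.1 → L.Term ℕ

/-- First-order formulas; `¬ φ` is `φ → ⊥` and `⊤` is `⊥ → ⊥`. -/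
inductive FOFormula (L : FirstOrder.Language.{u, v}) : Type (max u v)
  | falsum : FOFormula L
  | eq (s t : L.Term ℕ) : FOFormula L
  | atom (A : Atom L) : FOFormula L
  | and (φ ψ : FOFormula L) : FOFormula L
  | or (φ ψ : FOFormula L) : FOFormula L
  | imp (φ ψ : FOFormula L) : FOFormula L
  | all (x : ℕ) (φ : FOFormula L) : FOFormula L
  | ex (x : ℕ) (φ : FOFormula L) : FOFormula L

namespace FOFormula

variable {L : FirstOrder.Language.{u, v}}

def not (φ : FOFormula L) : FOFormula L := imp φ falsum

def top : FOFormula L := imp falsum falsum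

/-- The conjunction of a list of formulas (`⊤` for the empty list). -/
def conj (l : List (FOFormula L)) : FOFormula L := l.foldr and top

def freeVars : FOFormula L → Finset ℕ
  | falsum => ∅
  | eq s t => s.varFinset ∪ t.varFinset
  | atom A => Finset.univ.biUnion fun i => (A.args i).varFinset
  | and φ ψ => φ.freeVars ∪ ψ.freeVars
  | or φ ψ => φ.freeVars ∪ ψ.freeVars
  | imp φ ψ => φ.freeVars ∪ ψ.freeVars
  | all x φ => φ.freeVars.erase x
  | ex x φ => φ.freeVars.erase x

/-- `∀ x̄ φ`, where `x̄` lists the free variables of `φ`. -/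
noncomputable def univClosure (φ : FOFormula L) : FOFormula L :=
  φ.freeVars.toList.foldr all φ

/-- `∃ x̄ φ`, where `x̄` lists the free variables of `φ`. -/
noncomputable def exClosure (φ : FOFormula L) : FOFormula L :=
  φ.freeVars.toList.foldr ex φ

theorem freeVars_foldr_all (l : List ℕ) (φ : FOFormula L) (x : ℕ) :
    x ∈ (l.foldr all φ).freeVars ↔ x ∈ φ.freeVars ∧ x ∉ l := by
  induction l with
  | nil => simp
  | cons a l ih => simp [freeVars, ih]; tauto

theorem freeVars_foldr_ex (l : List ℕ) (φ : FOFormula L) (x : ℕ) :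
    x ∈ (l.foldr ex φ).freeVars ↔ x ∈ φ.freeVars ∧ x ∉ l := by
  induction l with
  | nil => simp
  | cons a l ih => simp [freeVars, ih]; tauto

theorem freeVars_univClosure (φ : FOFormula L) : φ.univClosure.freeVars = ∅ := by
  ext x; simp [univClosure, freeVars_foldr_all]

theorem freeVars_exClosure (φ : FOFormula L) : φ.exClosure.freeVars = ∅ := by
  ext x; simp [exClosure, freeVars_foldr_ex]

theorem freeVars_conj (l : List (FOFormula L)) (h : ∀ φ ∈ l, φ.freeVars = ∅) :
    (conj l).freeVars = ∅ := by
  induction l with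
  | nil => simp [conj, top, freeVars]
  | cons a l ih =>
    have h1 : (conj l).freeVars = ∅ := ih fun φ hφ => h φ (List.mem_cons_of_mem _ hφ)
    have h2 : a.freeVars = ∅ := h a List.mem_cons_self
    have h3 : conj (a :: l) = and a (conj l) := rfl
    rw [h3, freeVars, h1, h2]; rfl

end FOFormula

/-- First-order sentences: formulas without free variables. -/
structure FOSentence (L : FirstOrder.Language.{u, v}) where
  formula : FOFormula L
  closed : formula.freeVars = ∅

/-! ### Interpretations

An interpretation of the vocabulary is a non-empty type `M` with `[L.Structure M]`. Structures
with the domain and the function values of `M` but other relations are given by a `RelInterp`. -/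

/-- Values for all predicate symbols on the domain `M`. The pointwise inclusion order `≤` is the
truth order. -/
abbrev RelInterp (L : FirstOrder.Language.{u, v}) (M : Type w) : Type (max v w) :=
  (P : Pred L) → Set (Fin P.1 → M)

/-- The values of the predicate symbols in the interpretation `M`. -/
def relOf (L : FirstOrder.Language.{u, v}) (M : Type w) [L.Structure M] : RelInterp L M :=
  fun P => {xs | FirstOrder.Language.Structure.RelMap P.2 xs}

section Semantics

variable {L : FirstOrder.Language.{u, v}} {M : Type w} [L.Structure M]

/-- The tuple of values of the arguments of an atom under an assignment of the variables. -/
def Atom.val (A : Atom L) (s : ℕ → M) : Fin A.pred.1 → M := fun i => (A.args i).realize s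

/-- Truth of an atom. -/
def Atom.Holds (I : RelInterp L M) (A : Atom L) (s : ℕ → M) : Prop := A.val s ∈ I A.pred

/-- The classical satisfaction relation. -/
def FOFormula.Sat (I : RelInterp L M) : FOFormula L → (ℕ → M) → Prop
  | .falsum, _ => False
  | .eq a b, s => a.realize s = b.realize s
  | .atom A, s => A.Holds I s
  | .and φ ψ, s => φ.Sat I s ∧ ψ.Sat I s
  | .or φ ψ, s => φ.Sat I s ∨ ψ.Sat I s
  | .imp φ ψ, s => φ.Sat I s → ψ.Sat I s
  | .all x φ, s => ∀ d : M, φ.Sat I (Function.update s x d)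
  | .ex x φ, s => ∃ d : M, φ.Sat I (Function.update s x d)

/-- Satisfaction of a formula by a pair of interpretations `(A, B)` with the same domain and
function values: positive occurrences of atoms are read in `A`, negative ones in `B`. -/
def FOFormula.PairSat : FOFormula L → RelInterp L M → RelInterp L M → (ℕ → M) → Prop
  | .falsum, _, _, _ => False
  | .eq a b, _, _, s => a.realize s = b.realize s
  | .atom C, A, _, s => C.Holds A s
  | .and φ ψ, A, B, s => φ.PairSat A B s ∧ ψ.PairSat A B s
  | .or φ ψ, A, B, s => φ.PairSat A B s ∨ ψ.PairSat A B s
  | .imp φ ψ, A, B, s => φ.PairSat B A s → ψ.PairSat A B s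
  | .all x φ, A, B, s => ∀ d : M, φ.PairSat A B (Function.update s x d)
  | .ex x φ, A, B, s => ∃ d : M, φ.PairSat A B (Function.update s x d)

/-- Truth of a sentence (independent of the assignment). -/
def FOSentence.Sat (I : RelInterp L M) (F : FOSentence L) : Prop := ∀ s : ℕ → M, F.formula.Sat I s

/-! ### The stable model operator -/

open Classical in
/-- Truth of the formula `F*(u)` of the stable model operator `SM_p` when the predicate symbols
are interpreted by `I` and the predicate variables `u` (one for each symbol in `p`) by `U`:
intensional atoms `P(t)`, `P ∈ p`, become `u_P(t)`; an implication `F → G` becomes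
`(F* → G*) ∧ (F → G)`; everything else is unchanged. -/
def FOFormula.StarSat (p : Set (Pred L)) (I U : RelInterp L M) : FOFormula L → (ℕ → M) → Prop
  | .falsum, _ => False
  | .eq a b, s => a.realize s = b.realize s
  | .atom A, s => if A.pred ∈ p then A.Holds U s else A.Holds I s
  | .and φ ψ, s => φ.StarSat p I U s ∧ ψ.StarSat p I U s
  | .or φ ψ, s => φ.StarSat p I U s ∨ ψ.StarSat p I U s
  | .imp φ ψ, s => (φ.StarSat p I U s → ψ.StarSat p I U s) ∧ (φ.Sat I s → ψ.Sat I s)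
  | .all x φ, s => ∀ d : M, φ.StarSat p I U (Function.update s x d)
  | .ex x φ, s => ∃ d : M, φ.StarSat p I U (Function.update s x d)

/-- `u < p`, that is `(u ≤ p) ∧ ¬ (p ≤ u)`, for the predicates in `p`. -/
def LTOn (p : Set (Pred L)) (U I : RelInterp L M) : Prop :=
  (∀ P ∈ p, U P ⊆ I P) ∧ ¬ ∀ P ∈ p, I P ⊆ U P

/-- `I` is a model of the second-order sentence `SM_p(F) = F ∧ ¬∃u ((u < p) ∧ F*(u))`. -/
def SatSM (p : Set (Pred L)) (I : RelInterp L M) (F : FOSentence L) : Prop :=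
  F.Sat I ∧ ¬ ∃ U : RelInterp L M, LTOn p U I ∧ ∀ s : ℕ → M, F.formula.StarSat p I U s

end Semantics

/-! ### Core ASP programs -/

/-- Body atoms: atoms `P(t₁, …, tₙ)` and equations `s = t`. -/
inductive BodyAtom (L : FirstOrder.Language.{u, v}) : Type (max u v)
  | pred (A : Atom L) : BodyAtom L
  | eq (s t : L.Term ℕ) : BodyAtom L

/-- Rule heads: `{A}` (choice rule), `A` (normal rule), or nothing (constraint). -/
inductive RuleHead (L : FirstOrder.Language.{u, v}) : Type (max u v)
  | choice (A : Atom L) : RuleHead L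
  | normal (A : Atom L) : RuleHead L
  | constraint : RuleHead L

/-- A core ASP rule `head ← B₁, …, Bₙ, not C₁, …, not Cₘ`. -/
structure CoreRule (L : FirstOrder.Language.{u, v}) where
  head : RuleHead L
  pos : List (BodyAtom L)
  neg : List (BodyAtom L)

/-- A core ASP program: a finite set of rules. -/
abbrev CoreProgram (L : FirstOrder.Language.{u, v}) := Finset (CoreRule L)

section Programs

variable {L : FirstOrder.Language.{u, v}}

def BodyAtom.toFormula : BodyAtom L → FOFormula L
  | .pred A => .atom A
  | .eq s t => .eq s t

/-- The formula `B₁ ∧ ⋯ ∧ Bₙ ∧ ¬C₁ ∧ ⋯ ∧ ¬Cₘ`. -/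
def CoreRule.body (r : CoreRule L) : FOFormula L :=
  .conj (r.pos.map BodyAtom.toFormula ++ r.neg.map fun C => C.toFormula.not)

/-- The predicate `P` occurs in the head of the rule. -/
def CoreRule.HasHead (r : CoreRule L) (P : Pred L) : Prop :=
  ∃ A : Atom L, (r.head = .choice A ∨ r.head = .normal A) ∧ A.pred = P

/-- `hd(Π)`: the predicates that occur in the heads of the rules of the program. -/
def hd (Prog : CoreProgram L) : Set (Pred L) := {P | ∃ r ∈ Prog, r.HasHead P}

/-- The sentence of a rule: `∀x̄ (body → A)` for a normal rule, `∀x̄ (¬¬A ∧ body → A)` for a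
choice rule, `¬∃x̄ body` for a constraint. -/
noncomputable def CoreRule.tilde (r : CoreRule L) : FOFormula L :=
  match r.head with
  | .choice A => (FOFormula.imp (.and (FOFormula.atom A).not.not r.body) (.atom A)).univClosure
  | .normal A => (FOFormula.imp r.body (.atom A)).univClosure
  | .constraint => r.body.exClosure.not

theorem CoreRule.freeVars_tilde (r : CoreRule L) : r.tilde.freeVars = ∅ := by
  unfold CoreRule.tilde
  split
  · exact FOFormula.freeVars_univClosure _
  · exact FOFormula.freeVars_univClosure _
  · simp [FOFormula.not, FOFormula.freeVars, FOFormula.freeVars_exClosure]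

/-- The sentence of a program: the conjunction of the sentences of its rules. -/
noncomputable def tilde (Prog : CoreProgram L) : FOSentence L where
  formula := .conj (Prog.toList.map CoreRule.tilde)
  closed := by
    apply FOFormula.freeVars_conj
    intro φ hφ
    obtain ⟨r, -, rfl⟩ := List.mem_map.1 hφ
    exact r.freeVars_tilde

end Programs

/-- `M` is a Herbrand interpretation: its elements are the ground terms, each ground term denoting
itself. Domains are only compared up to the (unique) identification of ground terms with their
values: every element of the domain is the value of exactly one ground term. -/
def IsHerbrand (L : FirstOrder.Language.{u, v}) (M : Type w) [L.Structure M] : Prop :=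
  Function.Bijective fun t : L.Term Empty => (t.realize Empty.elim : M)

/-- `M` is a general answer set of the program: a model of `SM_p` of its sentence, where `p`
consists of all predicates of the vocabulary. -/
def IsGeneralAnswerSet {L : FirstOrder.Language.{u, v}} (M : Type w) [L.Structure M]
    (Prog : CoreProgram L) : Prop :=
  SatSM Set.univ (relOf L M) (tilde Prog)

/-- `M` is an answer set of the program: a Herbrand general answer set. -/
def IsAnswerSet {L : FirstOrder.Language.{u, v}} (M : Type w) [L.Structure M] (Prog : CoreProgram L) : Prop :=
  IsHerbrand L M ∧ IsGeneralAnswerSet M Prog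

/-! ### Splittings -/

section Splittings

variable {L : FirstOrder.Language.{u, v}}

/-- Edges of the positive predicate dependency graph. -/
def PosEdge (Prog : CoreProgram L) (P Q : Pred L) : Prop :=
  ∃ r ∈ Prog, r.HasHead P ∧ ∃ B : Atom L, BodyAtom.pred B ∈ r.pos ∧ B.pred = Q

/-- `P` positively depends on `Q`: there is a path of non-zero length from `P` to `Q`. -/
def PosDepends (Prog : CoreProgram L) : Pred L → Pred L → Prop :=
  Relation.TransGen (PosEdge Prog)

/-- The family `Π₁, …, Πₙ` is a partition of the program (into non-empty parts) that is a
splitting. -/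
structure IsSplitting (Prog : CoreProgram L) {n : ℕ} (parts : Fin n → CoreProgram L) : Prop where
  nonempty : ∀ i, (parts i).Nonempty
  disjoint : ∀ i j, i ≠ j → Disjoint (parts i) (parts j)
  cover : ∀ r, r ∈ Prog ↔ ∃ i, r ∈ parts i
  constraint_singleton : ∀ i, ∀ r ∈ parts i, r.head = .constraint → parts i = {r}
  same_head : ∀ P i j, P ∈ hd (parts i) → P ∈ hd (parts j) → i = j
  mutual_dep : ∀ P Q i j, PosDepends Prog P Q → PosDepends Prog Q P →
    P ∈ hd (parts i) → Q ∈ hd (parts j) → i = j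

/-- A proper splitting. -/
structure IsProperSplitting (Prog : CoreProgram L) {n : ℕ} (parts : Fin n → CoreProgram L) : Prop
    extends IsSplitting Prog parts where
  one_choice_pred : ∀ i, ∀ r ∈ parts i, ∀ r' ∈ parts i, ∀ A A' : Atom L,
    r.head = .choice A → r'.head = .choice A' → A.pred = A'.pred
  not_mixed : ∀ i, ∀ r ∈ parts i, ∀ r' ∈ parts i, ∀ A A' : Atom L,
    r.head = .choice A → r'.head ≠ .normal A'
  choice_nonrec : ∀ i, ∀ r ∈ parts i, ∀ A : Atom L,
    r.head = .choice A → ¬ PosDepends Prog A.pred A.pred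

end Splittings

/-! ### ASP-FO -/

/-- The data of a choice rule `∀x̄ ({P(t̄)} ← φ)` or of a define rule `∀x̄ (P(t̄) ← φ)`. All free
variables are understood to be bound by `∀x̄`. -/
structure FORule (L : FirstOrder.Language.{u, v}) where
  head : Atom L
  body : FOFormula L

/-- A G-module: a finite set of choice rules with the same head predicate. Occurrences of the head
predicate in the bodies are not excluded (a rule such as `{p} ← not p` may occur in a choice part of
a proper splitting); the semantics applies to these modules as well. -/
structure GModule (L : FirstOrder.Language.{u, v}) where
  pred : Pred L
  rules : Set (FORule L)
  finite : rules.Finite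
  head_eq : ∀ r ∈ rules, r.head.pred = pred

/-- A D-module `(Def, Π)`: a finite set of defined predicates and a finite set of define rules
with head predicates in `Def`. -/
structure DModule (L : FirstOrder.Language.{u, v}) where
  defd : Set (Pred L)
  finite_defd : defd.Finite
  rules : Set (FORule L)
  finite : rules.Finite
  head_mem : ∀ r ∈ rules, r.head.pred ∈ defd

/-- Modules: G-modules, D-modules, T-modules (sentences), and Herbrand modules over a set of
function symbols. -/
inductive FOModule (L : FirstOrder.Language.{u, v}) : Type (max u v)
  | G (m : GModule L) : FOModule L
  | D (m : DModule L) : FOModule L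
  | T (F : FOSentence L) : FOModule L
  | H (σ : Set (Fun L)) : FOModule L

/-- An ASP-FO theory: a finite set of modules. -/
structure FOTheory (L : FirstOrder.Language.{u, v}) where
  modules : Set (FOModule L)
  finite : modules.Finite

/-- The function symbols of the term all belong to `σ`. -/
def BuiltFrom {L : FirstOrder.Language.{u, v}} {α : Type*} (σ : Set (Fun L)) : L.Term α → Prop
  | .var _ => True
  | .func (l := l) f ts => (⟨l, f⟩ : Fun L) ∈ σ ∧ ∀ i, BuiltFrom σ (ts i)

section ModuleSemantics

variable {L : FirstOrder.Language.{u, v}} {M : Type w}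

/-- Values for the predicates in `Def`; the order `≤` is the truth order. -/
abbrev DefInterp (M : Type w) (Def : Set (Pred L)) : Type (max v w) :=
  (P : Def) → Set (Fin P.1.1 → M)

open Classical in
/-- The interpretation `I ∘ A` that agrees with `A` on `Def` and with `I` on all other symbols. -/
noncomputable def compose (I : RelInterp L M) {Def : Set (Pred L)} (A : DefInterp M Def) :
    RelInterp L M :=
  fun P => if h : P ∈ Def then A ⟨P, h⟩ else I P

/-- The restriction of an interpretation to the predicates in `Def`. -/
def restrict (I : RelInterp L M) (Def : Set (Pred L)) : DefInterp M Def := fun P => I P.1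

variable [L.Structure M]

/-- A pair `(A, B)` of interpretations satisfies a define rule. -/
def FORule.PairSat (A B : RelInterp L M) (r : FORule L) : Prop :=
  ∀ s : ℕ → M, r.body.PairSat A B s → r.head.Holds A s

/-- `S` is a stable model of the D-module relative to the values that `I` gives to the parameter
symbols (the values of `I` on the defined predicates are not used). -/
def DModule.IsStable (m : DModule L) (I : RelInterp L M) (S : DefInterp M m.defd) : Prop :=
  IsLeast {A : DefInterp M m.defd | ∀ r ∈ m.rules, r.PairSat (compose I A) (compose I S)} S

/-- Models of a D-module. -/
def DModule.Sat (m : DModule L) (I : RelInterp L M) : Prop := m.IsStable I (restrict I m.defd)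

/-- Models of a G-module: every tuple `d` in the value of the head predicate `P` is generated by
some instance of a choice rule whose body is true. -/
def GModule.Sat (m : GModule L) (I : RelInterp L M) : Prop :=
  ∀ d : Fin m.pred.1 → M, d ∈ I m.pred →
    ∃ r ∈ m.rules, ∃ s : ℕ → M,
      (⟨r.head.pred, r.head.val s⟩ : Σ P : Pred L, Fin P.1 → M) = ⟨m.pred, d⟩ ∧ r.body.Sat I s

variable (M) in
/-- `M` is a model of the Herbrand module over `σ`: its elements are the ground terms built from
`σ`, each denoting itself (with the same identification as in `IsHerbrand`). -/
def SatHerbrand (σ : Set (Fun L)) : Prop :=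
  Function.Bijective fun t : {t : L.Term Empty // BuiltFrom σ t} =>
    (t.1.realize Empty.elim : M)

variable (M) in
/-- `M` is a model of a module. -/
def FOModule.Models : FOModule L → Prop
  | .G m => m.Sat (relOf L M)
  | .D m => m.Sat (relOf L M)
  | .T F => F.Sat (relOf L M)
  | .H σ => SatHerbrand M σ

variable (M) in
/-- `M` is a model of a theory if it is a model of each of its modules. -/
def FOTheory.Models (T : FOTheory L) : Prop := ∀ m ∈ T.modules, m.Models M

end ModuleSemantics

/-! ### The translation of core ASP into ASP-FO -/

section Translation

variable {L : FirstOrder.Language.{u, v}}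

/-- The G-module of all choice rules of the program with head predicate `P`. -/
def gPart (Prog : CoreProgram L) (P : Pred L) : GModule L where
  pred := P
  rules := {c | ∃ r ∈ Prog, ∃ A : Atom L, r.head = .choice A ∧ A.pred = P ∧ c = ⟨A, r.body⟩}
  finite := by
    refine (Prog.finite_toSet.biUnion (t := fun r => {c : FORule L |
      ∃ A : Atom L, r.head = .choice A ∧ c = ⟨A, r.body⟩}) fun r _ => ?_).subset ?_
    · apply Set.Subsingleton.finite
      rintro _ ⟨A, hA, rfl⟩ _ ⟨B, hB, rfl⟩
      rw [hA] at hB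
      cases hB
      rfl
    · rintro c ⟨r, hr, A, hA, -, rfl⟩
      exact Set.mem_biUnion (Finset.mem_coe.2 hr) ⟨A, hA, rfl⟩
  head_eq := by
    rintro c ⟨r, -, A, -, hP, rfl⟩
    exact hP

/-- The D-module of all normal rules of the program, defining their head predicates. -/
def dPart (Prog : CoreProgram L) : DModule L where
  defd := {P | ∃ r ∈ Prog, ∃ A : Atom L, r.head = .normal A ∧ A.pred = P}
  finite_defd := by
    refine (Prog.finite_toSet.biUnion (t := fun r => {P : Pred L |
      ∃ A : Atom L, r.head = .normal A ∧ A.pred = P}) fun r _ => ?_).subset ?_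
    · apply Set.Subsingleton.finite
      rintro _ ⟨A, hA, rfl⟩ _ ⟨B, hB, rfl⟩
      rw [hA] at hB
      cases hB
      rfl
    · rintro c ⟨r, hr, A, hA, rfl⟩
      exact Set.mem_biUnion (Finset.mem_coe.2 hr) ⟨A, hA, rfl⟩
  rules := {c | ∃ r ∈ Prog, ∃ A : Atom L, r.head = .normal A ∧ c = ⟨A, r.body⟩}
  finite := by
    refine (Prog.finite_toSet.biUnion (t := fun r => {c : FORule L |
      ∃ A : Atom L, r.head = .normal A ∧ c = ⟨A, r.body⟩}) fun r _ => ?_).subset ?_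
    · apply Set.Subsingleton.finite
      rintro _ ⟨A, hA, rfl⟩ _ ⟨B, hB, rfl⟩
      rw [hA] at hB
      cases hB
      rfl
    · rintro c ⟨r, hr, A, hA, rfl⟩
      exact Set.mem_biUnion (Finset.mem_coe.2 hr) ⟨A, hA, rfl⟩
  head_mem := by
    rintro c ⟨r, hr, A, hA, rfl⟩
    exact ⟨r, hr, A, hA, rfl⟩

/-- The T-module `∀x̄ ¬ body` of a constraint. -/
noncomputable def tPart (r : CoreRule L) : FOSentence L where
  formula := r.body.not.univClosure
  closed := FOFormula.freeVars_univClosure _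

/-- The translation of a program: choice rules are grouped by their head predicate into G-modules,
normal rules form one D-module, and each constraint is a T-module. Each part of a proper splitting
is thus translated into exactly one module, see `hat_part`. -/
def hat (Prog : CoreProgram L) : Set (FOModule L) :=
  {m | ∃ r ∈ Prog,
    (∃ A : Atom L, r.head = .choice A ∧ m = .G (gPart Prog A.pred)) ∨
    (∃ A : Atom L, r.head = .normal A ∧ m = .D (dPart Prog)) ∨
    (r.head = .constraint ∧ m = .T (tPart r))}

theorem hat_finite (Prog : CoreProgram L) : (hat Prog).Finite := by
  refine (Prog.finite_toSet.biUnion (t := fun r => {m : FOModule L |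
    (∃ A : Atom L, r.head = .choice A ∧ m = .G (gPart Prog A.pred)) ∨
    (∃ A : Atom L, r.head = .normal A ∧ m = .D (dPart Prog)) ∨
    (r.head = .constraint ∧ m = .T (tPart r))}) fun r _ => ?_).subset ?_
  · apply Set.Subsingleton.finite
    intro a ha b hb
    cases h : r.head <;> simp_all
  · rintro m ⟨r, hr, h⟩
    exact Set.mem_biUnion (Finset.mem_coe.2 hr) h

/-- Each part of a proper splitting is translated into a single module: the G-module of all its
rules, the D-module `(hd(Πᵢ), Πᵢ)` of all its rules, or the T-module of its only rule. -/
theorem hat_part {Prog : CoreProgram L} {n : ℕ} {parts : Fin n → CoreProgram L}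
    (h : IsProperSplitting Prog parts) (i : Fin n) :
    (∃ P, hat (parts i) = {.G (gPart (parts i) P)} ∧
      ∀ r ∈ parts i, ∃ A : Atom L, r.head = .choice A ∧ A.pred = P) ∨
    (hat (parts i) = {.D (dPart (parts i))} ∧ (dPart (parts i)).defd = hd (parts i) ∧
      ∀ r ∈ parts i, ∃ A : Atom L, r.head = .normal A) ∨
    (∃ r, parts i = {r} ∧ r.head = .constraint ∧ hat (parts i) = {.T (tPart r)}) := by
  obtain ⟨r₀, hr₀⟩ := h.nonempty i
  have hc : ∀ r ∈ parts i, r.head = .constraint → r = r₀ := by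
    intro r hr hr'
    have := h.constraint_singleton i r hr hr'
    rw [this, Finset.mem_singleton] at hr₀
    exact hr₀.symm
  cases e : r₀.head with
  | choice A =>
    have key : ∀ r ∈ parts i, ∃ B : Atom L, r.head = .choice B ∧ B.pred = A.pred := by
      intro r hr
      cases e' : r.head with
      | choice B => exact ⟨B, rfl, h.one_choice_pred i r hr r₀ hr₀ B A e' e⟩
      | normal B => exact absurd e' (h.not_mixed i r₀ hr₀ r hr A B e)
      | constraint => rw [hc r hr e', e] at e'; cases e'
    refine Or.inl ⟨A.pred, ?_, key⟩
    ext m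
    constructor
    · rintro ⟨r, hr, hm⟩
      obtain ⟨B, hB, hBA⟩ := key r hr
      rcases hm with ⟨C, hC, rfl⟩ | ⟨C, hC, rfl⟩ | ⟨hC, rfl⟩
      · rw [hB] at hC; cases hC; rw [hBA]; rfl
      · rw [hB] at hC; cases hC
      · rw [hB] at hC; cases hC
    · rintro rfl
      exact ⟨r₀, hr₀, Or.inl ⟨A, e, rfl⟩⟩
  | normal A =>
    have key : ∀ r ∈ parts i, ∃ B : Atom L, r.head = .normal B := by
      intro r hr
      cases e' : r.head with
      | choice B => exact absurd e (h.not_mixed i r hr r₀ hr₀ B A e')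
      | normal B => exact ⟨B, rfl⟩
      | constraint => rw [hc r hr e', e] at e'; cases e'
    refine Or.inr (Or.inl ⟨?_, ?_, key⟩)
    · ext m
      constructor
      · rintro ⟨r, hr, hm⟩
        obtain ⟨B, hB⟩ := key r hr
        rcases hm with ⟨C, hC, rfl⟩ | ⟨C, hC, rfl⟩ | ⟨hC, rfl⟩
        · rw [hB] at hC; cases hC
        · rfl
        · rw [hB] at hC; cases hC
      · rintro rfl
        exact ⟨r₀, hr₀, Or.inr (Or.inl ⟨A, e, rfl⟩)⟩
    · ext P
      constructor
      · rintro ⟨r, hr, B, hB, rfl⟩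
        exact ⟨r, hr, B, Or.inr hB, rfl⟩
      · rintro ⟨r, hr, B, hB, rfl⟩
        obtain ⟨C, hC⟩ := key r hr
        rcases hB with hB | hB
        · rw [hB] at hC; cases hC
        · exact ⟨r, hr, B, hB, rfl⟩
  | constraint =>
    have hs := h.constraint_singleton i r₀ hr₀ e
    refine Or.inr (Or.inr ⟨r₀, hs, e, ?_⟩)
    rw [hs]
    ext m
    simp [hat, e]

/-- The D-module `(Def, {})` without rules. -/
def emptyD [Finite (Pred L)] (Def : Set (Pred L)) : DModule L where
  defd := Def
  finite_defd := Set.toFinite _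
  rules := ∅
  finite := Set.finite_empty
  head_mem := by simp

/-- The theory consisting of the Herbrand module over all function symbols, the translations of
`Π₁, …, Πₙ`, and the D-module without rules whose defined predicates are those outside `hd(Π)`. -/
def splitTheory [Finite (Pred L)] (Prog : CoreProgram L) {n : ℕ}
    (parts : Fin n → CoreProgram L) : FOTheory L where
  modules := {.H Set.univ} ∪ (⋃ i, hat (parts i)) ∪ {.D (emptyD (Set.univ \ hd Prog))}
  finite := ((Set.finite_singleton _).union (Set.finite_iUnion fun _ => hat_finite _)).union
    (Set.finite_singleton _)

end Translation

end ASPFO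

/-! Since `U ≤ I`, the sentence `F*(U)` of a program only says that `U` is closed under the reduct
with respect to `I`: negated body atoms are read in `I`, and a choice rule may derive its head only
if `I` contains it. By `satSM_tilde_iff`, `I` is therefore stable iff it satisfies every rule and no
closed `U ≤ I` is strictly smaller. The Herbrand condition occurs on both sides and cancels, so the
equivalence concerns stability alone.

From stability to the modules, minimality is tested on one set `U` per module, obtained by shrinking
`I` only on the predicates of that module: to nothing outside `hd Prog` (`empty_of_stable`), to the
generated tuples of a choice predicate (`gPart_sat_of_stable`), to the meet of `I` with a competing
interpretation of the defined predicates (`dPart_sat_of_stable`). All rules for these predicates lie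
in one unmixed part, so `U` is closed.

Conversely, the modules make `I` a model of the rules, and `le_of_isClosed` gives `I ≤ U` for every
closed `U ≤ I`. The proof is an induction over the strongly connected components of the positive
dependency graph, which is finite. A choice predicate depends only on strictly lower predicates, and
a component of normal predicates lies inside one D-module, whose leastness applies. -/

namespace ASPFO

/-! ### Conjunctions and quantifier closures -/

section Closures

variable {L : FirstOrder.Language.{u, v}} {M : Type w} [L.Structure M]

theorem FOFormula.sat_conj (I : RelInterp L M) (l : List (FOFormula L)) (s : ℕ → M) :
    (FOFormula.conj l).Sat I s ↔ ∀ φ ∈ l, φ.Sat I s := by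
  induction l with
  | nil => simp [conj, top, Sat]
  | cons a l ih =>
    have h : conj (a :: l) = and a (conj l) := rfl
    simp [h, Sat, ih]

theorem FOFormula.pairSat_conj (A B : RelInterp L M) (l : List (FOFormula L)) (s : ℕ → M) :
    (FOFormula.conj l).PairSat A B s ↔ ∀ φ ∈ l, φ.PairSat A B s := by
  induction l with
  | nil => simp [conj, top, PairSat]
  | cons a l ih =>
    have h : conj (a :: l) = and a (conj l) := rfl
    simp [h, PairSat, ih]

theorem FOFormula.starSat_conj (p : Set (Pred L)) (I U : RelInterp L M)
    (l : List (FOFormula L)) (s : ℕ → M) :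
    (FOFormula.conj l).StarSat p I U s ↔ ∀ φ ∈ l, φ.StarSat p I U s := by
  induction l with
  | nil => simp [conj, top, StarSat]
  | cons a l ih =>
    have h : conj (a :: l) = and a (conj l) := rfl
    simp [h, StarSat, ih]

/-- Updating `s` at `x` by `s x` changes nothing, so a quantifier over all assignments absorbs one
over a single variable. Closures can thus be dropped without showing that truth depends only on the
free variables. -/
theorem forall_update_iff {ψ : (ℕ → M) → Prop} (x : ℕ) :
    (∀ s d, ψ (Function.update s x d)) ↔ ∀ s, ψ s :=
  ⟨fun h s => by simpa using h s (s x), fun h _ _ => h _⟩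

theorem exists_update_iff {ψ : (ℕ → M) → Prop} (x : ℕ) :
    (∃ s d, ψ (Function.update s x d)) ↔ ∃ s, ψ s :=
  ⟨fun ⟨_, _, h⟩ => ⟨_, h⟩, fun ⟨s, h⟩ => ⟨s, s x, by simpa using h⟩⟩

theorem FOFormula.forall_sat_univClosure (I : RelInterp L M) (φ : FOFormula L) :
    (∀ s, φ.univClosure.Sat I s) ↔ ∀ s, φ.Sat I s := by
  unfold univClosure
  induction φ.freeVars.toList with
  | nil => rfl
  | cons x l ih => exact (forall_update_iff x).trans ih

theorem FOFormula.forall_starSat_univClosure (p : Set (Pred L)) (I U : RelInterp L M)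
    (φ : FOFormula L) :
    (∀ s, φ.univClosure.StarSat p I U s) ↔ ∀ s, φ.StarSat p I U s := by
  unfold univClosure
  induction φ.freeVars.toList with
  | nil => rfl
  | cons x l ih => exact (forall_update_iff x).trans ih

theorem FOFormula.exists_sat_exClosure (I : RelInterp L M) (φ : FOFormula L) :
    (∃ s, φ.exClosure.Sat I s) ↔ ∃ s, φ.Sat I s := by
  unfold exClosure
  induction φ.freeVars.toList with
  | nil => rfl
  | cons x l ih => exact (exists_update_iff x).trans ih

theorem FOFormula.exists_starSat_exClosure (p : Set (Pred L)) (I U : RelInterp L M)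
    (φ : FOFormula L) :
    (∃ s, φ.exClosure.StarSat p I U s) ↔ ∃ s, φ.StarSat p I U s := by
  unfold exClosure
  induction φ.freeVars.toList with
  | nil => rfl
  | cons x l ih => exact (exists_update_iff x).trans ih

end Closures

/-! ### Stable models as minimal closed sets of the reduct -/

section Rules

variable {L : FirstOrder.Language.{u, v}} {M : Type w} [L.Structure M]

/-- Truth of a body atom. -/
def BodyAtom.Holds (I : RelInterp L M) (b : BodyAtom L) (s : ℕ → M) : Prop :=
  b.toFormula.Sat I s

theorem Atom.Holds.mono {A B : RelInterp L M} (h : A ≤ B) {C : Atom L} {s : ℕ → M}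
    (hC : C.Holds A s) : C.Holds B s :=
  h _ hC

theorem BodyAtom.Holds.mono {A B : RelInterp L M} (h : A ≤ B) {b : BodyAtom L} {s : ℕ → M}
    (hb : b.Holds A s) : b.Holds B s := by
  cases b with
  | pred C => exact Atom.Holds.mono h hb
  | eq _ _ => exact hb

theorem BodyAtom.pairSat_toFormula (A B : RelInterp L M) (b : BodyAtom L) (s : ℕ → M) :
    b.toFormula.PairSat A B s ↔ b.Holds A s := by
  cases b <;> rfl

theorem BodyAtom.starSat_toFormula (I U : RelInterp L M) (b : BodyAtom L) (s : ℕ → M) :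
    b.toFormula.StarSat Set.univ I U s ↔ b.Holds U s := by
  cases b <;> simp [toFormula, FOFormula.StarSat, Holds, FOFormula.Sat]

/-- Truth of the body of a rule, with the positive body atoms evaluated in `A` and the negated
ones in `B`. -/
def CoreRule.BodyHolds (r : CoreRule L) (A B : RelInterp L M) (s : ℕ → M) : Prop :=
  (∀ b ∈ r.pos, b.Holds A s) ∧ ∀ c ∈ r.neg, ¬ c.Holds B s

theorem CoreRule.BodyHolds.mono {r : CoreRule L} {A A' B : RelInterp L M} (h : A ≤ A')
    {s : ℕ → M} (hr : r.BodyHolds A B s) : r.BodyHolds A' B s :=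
  ⟨fun b hb => (hr.1 b hb).mono h, hr.2⟩

theorem CoreRule.sat_body (r : CoreRule L) (I : RelInterp L M) (s : ℕ → M) :
    r.body.Sat I s ↔ r.BodyHolds I I s := by
  simp [body, FOFormula.sat_conj, or_imp, forall_and, BodyHolds, FOFormula.not, FOFormula.Sat,
    BodyAtom.Holds]

theorem CoreRule.pairSat_body (r : CoreRule L) (A B : RelInterp L M) (s : ℕ → M) :
    r.body.PairSat A B s ↔ r.BodyHolds A B s := by
  simp [body, FOFormula.pairSat_conj, or_imp, forall_and, BodyHolds, FOFormula.not,
    FOFormula.PairSat, BodyAtom.pairSat_toFormula]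

/-- `(¬c)*` asks that `c` fail in both `U` and `I`; as body atoms are monotone and `U ≤ I`, failure
in `I` suffices. -/
theorem CoreRule.starSat_body (r : CoreRule L) {I U : RelInterp L M} (h : U ≤ I) (s : ℕ → M) :
    r.body.StarSat Set.univ I U s ↔ r.BodyHolds U I s := by
  have key : ∀ c : BodyAtom L,
      (c.toFormula.not).StarSat Set.univ I U s ↔ ¬ c.Holds I s := fun c => by
    simp only [FOFormula.not, FOFormula.StarSat, FOFormula.Sat, BodyAtom.starSat_toFormula]
    exact ⟨fun hc => hc.2, fun hc => ⟨fun hU => hc (hU.mono h), hc⟩⟩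
  simp [body, FOFormula.starSat_conj, or_imp, forall_and, BodyHolds, key,
    BodyAtom.starSat_toFormula]

/-- `I` satisfies the rule classically. -/
def CoreRule.IsModel (r : CoreRule L) (I : RelInterp L M) : Prop :=
  ∀ s, r.BodyHolds I I s →
    (∀ A, r.head = .normal A → A.Holds I s) ∧ r.head ≠ .constraint

/-- `U` is closed under the rule in the reduct with respect to `I`: a choice rule may only derive
atoms that are true in `I`. -/
def CoreRule.IsClosed (r : CoreRule L) (I U : RelInterp L M) : Prop :=
  ∀ s A, (r.head = .normal A ∨ r.head = .choice A ∧ A.Holds I s) →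
    r.BodyHolds U I s → A.Holds U s

theorem CoreRule.sat_tilde (r : CoreRule L) (I : RelInterp L M) :
    (∀ s, r.tilde.Sat I s) ↔ r.IsModel I := by
  unfold tilde IsModel
  split <;> rename_i h
  · rw [FOFormula.forall_sat_univClosure]
    simp [h, FOFormula.Sat, FOFormula.not]
    tauto
  · rw [FOFormula.forall_sat_univClosure]
    simp [h, FOFormula.Sat, CoreRule.sat_body]
  · have := not_congr (FOFormula.exists_sat_exClosure I r.body)
    simp only [not_exists] at this
    simp only [h, FOFormula.not, FOFormula.Sat, ← CoreRule.sat_body]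
    simpa using this

/-- The classical conjunct `F → G` that the star adds to an implication is supplied by `hI`. For a
choice rule, `(¬¬A)*` collapses to truth of `A` in `I`, which yields the side condition of
`IsClosed`. -/
theorem CoreRule.starSat_tilde (r : CoreRule L) {I U : RelInterp L M} (h : U ≤ I)
    (hI : r.IsModel I) :
    (∀ s, r.tilde.StarSat Set.univ I U s) ↔ r.IsClosed I U := by
  have hs := (r.sat_tilde I).2 hI
  unfold tilde IsClosed at *
  split <;> rename_i A hA
  · rw [FOFormula.forall_starSat_univClosure]
    simp only [hA, FOFormula.StarSat, FOFormula.not, FOFormula.Sat, r.starSat_body h, Set.mem_univ,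
      if_true]
    have mono : ∀ s, A.Holds U s → A.Holds I s := fun s => Atom.Holds.mono h
    constructor
    · rintro H s B (hB | ⟨hB, hBI⟩) hb <;> cases hB
      exact (H s).1 ⟨by tauto, hb⟩
    · intro H s
      have := H s A
      have := mono s
      tauto
  · rw [FOFormula.forall_starSat_univClosure]
    simp only [hA, FOFormula.forall_sat_univClosure] at hs
    simp only [hA, FOFormula.StarSat, r.starSat_body h, Set.mem_univ, if_true]
    constructor
    · rintro H s B (hB | ⟨hB, -⟩) hb <;> cases hB
      exact (H s).1 hb
    · exact fun H s => ⟨H s A (Or.inl rfl), hs s⟩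
  · rename_i hc
    simp only [hA, reduceCtorEq, false_and, or_self, false_implies, implies_true, iff_true]
    -- A body true for `U` stays true for `I`, where the constraint excludes it; so constraints put
    -- no condition on `U`.
    have hn : ¬ ∃ s, r.body.exClosure.StarSat Set.univ I U s := by
      rw [FOFormula.exists_starSat_exClosure]
      rintro ⟨s, hb⟩
      exact (hI s (((r.starSat_body h s).1 hb).mono h)).2 hA
    simp only [hA] at hs
    exact fun s => ⟨fun hb => hn ⟨s, hb⟩, hs s⟩

theorem sat_tilde (Prog : CoreProgram L) (I : RelInterp L M) :
    (tilde Prog).Sat I ↔ ∀ r ∈ Prog, r.IsModel I := by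
  simp only [FOSentence.Sat, tilde, FOFormula.sat_conj, List.mem_map, Finset.mem_toList,
    forall_exists_index, and_imp, forall_apply_eq_imp_iff₂, ← CoreRule.sat_tilde]
  exact ⟨fun h r hr s => h s r hr, fun h s r hr => h r hr s⟩

theorem starSat_tilde (Prog : CoreProgram L) {I U : RelInterp L M} (h : U ≤ I)
    (hI : ∀ r ∈ Prog, r.IsModel I) :
    (∀ s, (tilde Prog).formula.StarSat Set.univ I U s) ↔ ∀ r ∈ Prog, r.IsClosed I U := by
  simp only [tilde, FOFormula.starSat_conj, List.mem_map, Finset.mem_toList,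
    forall_exists_index, and_imp, forall_apply_eq_imp_iff₂]
  exact ⟨fun H r hr => (r.starSat_tilde h (hI r hr)).1 fun s => H s r hr,
    fun H s r hr => (r.starSat_tilde h (hI r hr)).2 (H r hr) s⟩

/-- The stable models of a program are its models that contain no smaller set closed under the
reduct. -/
theorem satSM_tilde_iff (Prog : CoreProgram L) (I : RelInterp L M) :
    SatSM Set.univ I (tilde Prog) ↔ (∀ r ∈ Prog, r.IsModel I) ∧
      ∀ U ≤ I, (∀ r ∈ Prog, r.IsClosed I U) → I ≤ U := by
  unfold SatSM
  rw [sat_tilde]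
  refine and_congr_right fun hI => ?_
  simp only [LTOn, Set.mem_univ, forall_const, not_exists, not_and, and_imp]
  constructor
  · intro H U hU hc
    by_contra hn
    exact H U hU hn ((starSat_tilde Prog hU hI).2 hc)
  · intro H U hU hn hs
    exact hn (H U hU ((starSat_tilde Prog hU hI).1 hs))

end Rules

/-! ### Overriding an interpretation on the defined predicates -/

section Compose

variable {L : FirstOrder.Language.{u, v}} {M : Type w}

theorem compose_of_mem (I : RelInterp L M) {Def : Set (Pred L)} (A : DefInterp M Def)
    {P : Pred L} (h : P ∈ Def) : compose I A P = A ⟨P, h⟩ :=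
  dif_pos h

theorem compose_of_notMem (I : RelInterp L M) {Def : Set (Pred L)} (A : DefInterp M Def)
    {P : Pred L} (h : P ∉ Def) : compose I A P = I P :=
  dif_neg h

theorem compose_restrict (I : RelInterp L M) (Def : Set (Pred L)) :
    compose I (restrict I Def) = I := by
  funext P
  by_cases h : P ∈ Def
  · rw [compose_of_mem _ _ h]; rfl
  · rw [compose_of_notMem _ _ h]

theorem compose_le_compose (I : RelInterp L M) {Def : Set (Pred L)} {A B : DefInterp M Def}
    (hAB : A ≤ B) : compose I A ≤ compose I B := by
  intro P
  by_cases h : P ∈ Def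
  · rw [compose_of_mem _ _ h, compose_of_mem _ _ h]; exact hAB _
  · rw [compose_of_notMem _ _ h, compose_of_notMem _ _ h]

end Compose

/-! ### Module semantics in terms of rules -/

section Modules

variable {L : FirstOrder.Language.{u, v}} {M : Type w} [L.Structure M]

theorem builtFrom_univ {α : Type*} (t : L.Term α) : BuiltFrom Set.univ t := by
  induction t with
  | var _ => trivial
  | func f ts ih => exact ⟨trivial, ih⟩

theorem satHerbrand_univ_iff : SatHerbrand (L := L) M Set.univ ↔ IsHerbrand L M := by
  let e : L.Term Empty ≃ {t : L.Term Empty // BuiltFrom Set.univ t} :=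
    (Equiv.subtypeUnivEquiv builtFrom_univ).symm
  exact (Function.Bijective.of_comp_iff _ e.bijective).symm

/-- Without rules every interpretation of `Def` is admissible, so the least one is empty. -/
theorem emptyD_sat_iff [Finite (Pred L)] (Def : Set (Pred L)) (I : RelInterp L M) :
    (emptyD Def).Sat I ↔ ∀ P ∈ Def, I P = ∅ := by
  have h0 : (emptyD Def).Sat I ↔ ∀ A : DefInterp M Def, restrict I Def ≤ A := by
    unfold DModule.Sat DModule.IsStable IsLeast lowerBounds
    simp only [Set.mem_ofPred_eq]
    exact ⟨fun h A => h.2 fun _ hr => absurd hr (Set.notMem_empty _),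
      fun h => ⟨fun _ hr => absurd hr (Set.notMem_empty _), fun A _ => h A⟩⟩
  rw [h0]
  constructor
  · intro h P hP
    exact Set.subset_empty_iff.1 (h (fun _ => ∅) ⟨P, hP⟩)
  · intro h A P
    rw [restrict, h P.1 P.2]
    exact Set.empty_subset _

theorem gPart_sat_iff (Prog : CoreProgram L) (P : Pred L) (I : RelInterp L M) :
    (gPart Prog P).Sat I ↔ ∀ d ∈ I P, ∃ r ∈ Prog, ∃ A : Atom L, r.head = .choice A ∧
      ∃ s, (⟨A.pred, A.val s⟩ : Σ P : Pred L, Fin P.1 → M) = ⟨P, d⟩ ∧ r.BodyHolds I I s := by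
  refine forall₂_congr fun d _ => ?_
  constructor
  · rintro ⟨_, ⟨r, hr, A, hA, -, rfl⟩, s, hs, hb⟩
    exact ⟨r, hr, A, hA, s, hs, (r.sat_body I s).1 hb⟩
  · rintro ⟨r, hr, A, hA, s, hs, hb⟩
    exact ⟨_, ⟨r, hr, A, hA, congrArg Sigma.fst hs, rfl⟩, s, hs, (r.sat_body I s).2 hb⟩

/-- The pair `(A, B)` satisfies the rules of the D-module of a program. -/
theorem dPart_pairSat_iff (Prog : CoreProgram L) (A B : RelInterp L M) :
    (∀ c ∈ (dPart Prog).rules, c.PairSat A B) ↔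
      ∀ r ∈ Prog, ∀ C, r.head = .normal C → ∀ s, r.BodyHolds A B s → C.Holds A s := by
  constructor
  · intro h r hr C hC s hb
    exact h _ ⟨r, hr, C, hC, rfl⟩ s ((r.pairSat_body A B s).2 hb)
  · rintro h _ ⟨r, hr, C, hC, rfl⟩ s hb
    exact h r hr C hC s ((r.pairSat_body A B s).1 hb)

/-- By `compose_restrict` the component that evaluates negative occurrences is `I` itself; what
remains is leastness for the reduct. -/
theorem dPart_sat_iff (Prog : CoreProgram L) (I : RelInterp L M) :
    (dPart Prog).Sat I ↔
      (∀ r ∈ Prog, ∀ C, r.head = .normal C → ∀ s, r.BodyHolds I I s → C.Holds I s) ∧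
      ∀ A : DefInterp M (dPart Prog).defd,
        (∀ r ∈ Prog, ∀ C, r.head = .normal C → ∀ s,
          r.BodyHolds (compose I A) I s → C.Holds (compose I A) s) →
        restrict I (dPart Prog).defd ≤ A := by
  unfold DModule.Sat DModule.IsStable IsLeast lowerBounds
  simp only [Set.mem_ofPred_eq, compose_restrict, dPart_pairSat_iff]

theorem tPart_sat_iff (r : CoreRule L) (I : RelInterp L M) :
    (tPart r).Sat I ↔ ∀ s, ¬ r.BodyHolds I I s := by
  simp only [FOSentence.Sat, tPart, FOFormula.forall_sat_univClosure, ← CoreRule.sat_body]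
  rfl

theorem models_hat_iff (Prog : CoreProgram L) :
    (∀ m ∈ hat Prog, m.Models M) ↔ ∀ r ∈ Prog,
      (∀ A, r.head = .choice A → (gPart Prog A.pred).Sat (relOf L M)) ∧
      (∀ A, r.head = .normal A → (dPart Prog).Sat (relOf L M)) ∧
      (r.head = .constraint → ∀ s : ℕ → M, ¬ r.BodyHolds (relOf L M) (relOf L M) s) := by
  constructor
  · intro h r hr
    refine ⟨fun A hA => h _ ⟨r, hr, Or.inl ⟨A, hA, rfl⟩⟩,
      fun A hA => h _ ⟨r, hr, Or.inr (Or.inl ⟨A, hA, rfl⟩)⟩, fun hc => ?_⟩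
    exact (tPart_sat_iff r _).1 (h _ ⟨r, hr, Or.inr (Or.inr ⟨hc, rfl⟩)⟩)
  · rintro h _ ⟨r, hr, ⟨A, hA, rfl⟩ | ⟨A, hA, rfl⟩ | ⟨hc, rfl⟩⟩
    · exact (h r hr).1 A hA
    · exact (h r hr).2.1 A hA
    · exact (tPart_sat_iff r _).2 ((h r hr).2.2 hc)

theorem splitTheory_models_iff [Finite (Pred L)] (Prog : CoreProgram L) {n : ℕ}
    (parts : Fin n → CoreProgram L) :
    (splitTheory Prog parts).Models M ↔ IsHerbrand L M ∧
      (∀ i, ∀ m ∈ hat (parts i), m.Models M) ∧ ∀ P ∉ hd Prog, relOf L M P = ∅ := by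
  have hD : (FOModule.D (emptyD (Set.univ \ hd Prog))).Models M ↔
      ∀ P ∉ hd Prog, relOf L M P = ∅ := by
    rw [FOModule.Models, emptyD_sat_iff]; simp
  rw [← satHerbrand_univ_iff, ← hD]
  constructor
  · intro h
    exact ⟨h _ (Or.inl (Or.inl rfl)),
      fun i m hm => h m (Or.inl (Or.inr (Set.mem_iUnion.2 ⟨i, hm⟩))), h _ (Or.inr rfl)⟩
  · rintro ⟨h1, h2, h3⟩ m ((rfl | hm) | rfl)
    · exact h1
    · obtain ⟨i, hm⟩ := Set.mem_iUnion.1 hm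
      exact h2 i m hm
    · exact h3

end Modules

/-! ### Stability versus the modules of a proper splitting -/

section Splitting

variable {L : FirstOrder.Language.{u, v}} {M : Type w} [L.Structure M]
  {Prog : CoreProgram L} {n : ℕ} {parts : Fin n → CoreProgram L}

theorem CoreRule.hasHead_choice {r : CoreRule L} {A : Atom L} (h : r.head = .choice A) :
    r.HasHead A.pred :=
  ⟨A, Or.inl h, rfl⟩

theorem CoreRule.hasHead_normal {r : CoreRule L} {A : Atom L} (h : r.head = .normal A) :
    r.HasHead A.pred :=
  ⟨A, Or.inr h, rfl⟩

theorem IsSplitting.mem_part (h : IsSplitting Prog parts) {P : Pred L} {i : Fin n}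
    (hP : P ∈ hd (parts i)) {r : CoreRule L} (hr : r ∈ Prog) (hrP : r.HasHead P) :
    r ∈ parts i := by
  obtain ⟨j, hj⟩ := (h.cover r).1 hr
  rwa [h.same_head P i j hP ⟨r, hj, hrP⟩]

theorem PosDepends.mem_hd {P Q : Pred L} (h : PosDepends Prog P Q) : P ∈ hd Prog := by
  obtain ⟨R, ⟨r, hr, hP, -⟩, -⟩ := Relation.TransGen.head'_iff.1 h
  exact ⟨r, hr, hP⟩

/-- This is the strict order between strongly connected components; being transitive and irreflexive
on a finite type, it is well-founded. -/
theorem PosDepends.wellFounded [Finite (Pred L)] :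
    WellFounded fun Q P => PosDepends Prog P Q ∧ ¬ PosDepends Prog Q P := by
  have : IsTrans (Pred L) fun Q P => PosDepends Prog P Q ∧ ¬ PosDepends Prog Q P :=
    ⟨fun _ _ _ hab hbc => ⟨hbc.1.trans hab.1, fun h => hab.2 (h.trans hbc.1)⟩⟩
  have : Std.Irrefl fun Q P => PosDepends Prog P Q ∧ ¬ PosDepends Prog Q P :=
    ⟨fun _ h => h.2 h.1⟩
  exact Finite.wellFounded_of_trans_of_irrefl _

theorem empty_of_stable {I : RelInterp L M}
    (hI : ∀ r ∈ Prog, r.IsModel I)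
    (hmin : ∀ U ≤ I, (∀ r ∈ Prog, r.IsClosed I U) → I ≤ U)
    {P : Pred L} (hP : P ∉ hd Prog) : I P = ∅ := by
  have h := hmin (fun Q => {d | d ∈ I Q ∧ Q ∈ hd Prog}) (fun Q d hd => hd.1) ?_ P
  · exact Set.eq_empty_of_forall_notMem fun d hd => hP (h hd).2
  · intro r hr s A hA hb
    have hb' := hb.mono (A' := I) fun Q d hd => hd.1
    rcases hA with hA | ⟨hA, hAI⟩
    · exact ⟨(hI r hr s hb').1 A hA, r, hr, CoreRule.hasHead_normal hA⟩
    · exact ⟨hAI, r, hr, CoreRule.hasHead_choice hA⟩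

/-- The test set drops from `I` the tuples of `A₀.pred` that no choice rule of the part generates.
It is closed, since every rule with this head predicate belongs to the part and none of them is
normal. -/
theorem IsProperSplitting.gPart_sat_of_stable (h : IsProperSplitting Prog parts)
    {I : RelInterp L M} (hI : ∀ r ∈ Prog, r.IsModel I)
    (hmin : ∀ U ≤ I, (∀ r ∈ Prog, r.IsClosed I U) → I ≤ U)
    {i : Fin n} {r₀ : CoreRule L} (hr₀ : r₀ ∈ parts i) {A₀ : Atom L}
    (hA₀ : r₀.head = .choice A₀) : (gPart (parts i) A₀.pred).Sat I := by
  rw [gPart_sat_iff]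
  have hU := hmin (fun Q => {d | d ∈ I Q ∧ (Q = A₀.pred → ∃ r ∈ parts i, ∃ A : Atom L,
    r.head = .choice A ∧ ∃ s, (⟨A.pred, A.val s⟩ : Σ P : Pred L, Fin P.1 → M) = ⟨Q, d⟩ ∧
      r.BodyHolds I I s)}) (fun Q d hd => hd.1) ?_
  · exact fun d hd => (hU _ hd).2 rfl
  · intro r hr s A hA hb
    have hb' := hb.mono (A' := I) fun Q d hd => hd.1
    have mem : r.HasHead A.pred → A.pred = A₀.pred → r ∈ parts i := fun hr' hp =>
      h.mem_part ⟨r₀, hr₀, CoreRule.hasHead_choice hA₀⟩ hr (hp ▸ hr')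
    rcases hA with hA | ⟨hA, hAI⟩
    · refine ⟨(hI r hr s hb').1 A hA, fun hp => ?_⟩
      exact absurd hA
        (h.not_mixed i r₀ hr₀ r (mem (CoreRule.hasHead_normal hA) hp) A₀ A hA₀)
    · exact ⟨hAI, fun hp => ⟨r, mem (CoreRule.hasHead_choice hA) hp, A, hA, s, rfl, hb'⟩⟩

theorem IsProperSplitting.dPart_sat_of_stable (h : IsProperSplitting Prog parts)
    {I : RelInterp L M} (hI : ∀ r ∈ Prog, r.IsModel I)
    (hmin : ∀ U ≤ I, (∀ r ∈ Prog, r.IsClosed I U) → I ≤ U) (i : Fin n) :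
    (dPart (parts i)).Sat I := by
  rw [dPart_sat_iff]
  have sub : ∀ r ∈ parts i, r ∈ Prog := fun r hr => (h.cover r).2 ⟨i, hr⟩
  refine ⟨fun r hr C hC s hb => (hI r (sub r hr) s hb).1 C hC, fun A hA => ?_⟩
  -- `A` need not lie below `I`, while minimality only speaks of subsets of `I`; hence the meet.
  have hle : compose I (A ⊓ restrict I _) ≤ I :=
    (compose_le_compose I inf_le_right).trans_eq (compose_restrict I _)
  have hU := hmin _ hle ?_
  · intro P d hd
    have := hU P.1 hd
    rw [compose_of_mem _ _ P.2] at this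
    exact this.1
  · intro r hr s C hC hb
    have hCI : C.Holds I s := by
      rcases hC with hC | hC
      · exact (hI r hr s (hb.mono hle)).1 C hC
      · exact hC.2
    have hrC : r.HasHead C.pred := ⟨C, hC.symm.imp_left And.left, rfl⟩
    by_cases hd : C.pred ∈ (dPart (parts i)).defd
    · obtain ⟨r', hr', C', hC', hp⟩ := id hd
      have hri : r ∈ parts i :=
        h.mem_part ⟨r', hr', hp ▸ CoreRule.hasHead_normal hC'⟩ hr hrC
      have hCn : r.head = .normal C := hC.resolve_right fun hc =>
        h.not_mixed i r hri r' hr' C C' hc.1 hC'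
      have := hA r hri C hCn s (hb.mono (compose_le_compose I inf_le_left))
      unfold Atom.Holds at this hCI ⊢
      rw [compose_of_mem _ _ hd] at this ⊢
      exact ⟨this, hCI⟩
    -- Outside the defined predicates the test set equals `I`, which already contains the head.
    · unfold Atom.Holds
      rw [compose_of_notMem _ _ hd]
      exact hCI

-- Induction on the component of `P`: the hypothesis gives `I ≤ U` on every predicate strictly below
-- `P`. Choice predicates use that their tuples are generated, normal predicates the leastness of
-- their D-module.
open Classical in
theorem IsProperSplitting.le_of_isClosed [Finite (Pred L)] (h : IsProperSplitting Prog parts)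
    {I U : RelInterp L M} (hE : ∀ P ∉ hd Prog, I P = ∅)
    (hG : ∀ i, ∀ r ∈ parts i, ∀ A, r.head = .choice A → (gPart (parts i) A.pred).Sat I)
    (hD : ∀ i, ∀ r ∈ parts i, ∀ A, r.head = .normal A → (dPart (parts i)).Sat I)
    (hUI : U ≤ I) (hU : ∀ r ∈ Prog, r.IsClosed I U) : I ≤ U := by
  have sub : ∀ i, ∀ r ∈ parts i, r ∈ Prog := fun i r hr => (h.cover r).2 ⟨i, hr⟩
  intro P
  induction P using (PosDepends.wellFounded (Prog := Prog)).induction with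
  | _ P ih =>
    by_cases hP : P ∈ hd Prog
    swap
    · rw [hE P hP]; exact Set.empty_subset _
    obtain ⟨r₀, hr₀, A₀, hA₀ | hA₀, rfl⟩ := hP <;> obtain ⟨i, hi⟩ := (h.cover r₀).1 hr₀
    · intro d hd
      obtain ⟨r, hr, A, hA, s, hs, hb⟩ := (gPart_sat_iff _ _ _).1 (hG i r₀ hi A₀ hA₀) d hd
      have hp : A.pred = A₀.pred := congrArg Sigma.fst hs
      -- The equality of dependent pairs transports membership without casting tuples between
      -- arities.
      have tr : ∀ V : RelInterp L M, A.Holds V s ↔ d ∈ V A₀.pred := fun V => by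
        have := congrArg (fun x : Σ P : Pred L, Fin P.1 → M => x.2 ∈ V x.1) hs
        exact this.to_iff
      refine (tr U).1 (hU r (sub i r hr) s A (Or.inr ⟨hA, (tr I).2 hd⟩) ⟨fun b hbp => ?_, hb.2⟩)
      have hbI := hb.1 b hbp
      cases b with
      | eq _ _ => exact hbI
      | pred B =>
        have hdep : PosDepends Prog A₀.pred B.pred :=
          .single ⟨r, sub i r hr, hp ▸ CoreRule.hasHead_choice hA, B, hbp, rfl⟩
        -- If `B.pred` depended back on the choice predicate, the latter would depend on itself.
        exact ih B.pred ⟨hdep, fun hd' => h.choice_nonrec i r₀ hi A₀ hA₀ (hdep.trans hd')⟩ hbI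
    -- The component of `A₀.pred`. The equality is listed separately because `PosDepends` needs a
    -- path of non-zero length.
    · let scc : Pred L → Prop := fun Q =>
        Q = A₀.pred ∨ PosDepends Prog A₀.pred Q ∧ PosDepends Prog Q A₀.pred
      have hdef : ∀ Q, scc Q → Q ∈ (dPart (parts i)).defd := by
        rintro Q (rfl | ⟨h1, h2⟩)
        · exact ⟨r₀, hi, A₀, hA₀, rfl⟩
        · obtain ⟨r, hr, hQ⟩ := h2.mem_hd
          obtain ⟨j, hj⟩ := (h.cover r).1 hr
          obtain rfl := h.mutual_dep _ _ i j h1 h2 ⟨r₀, hi, CoreRule.hasHead_normal hA₀⟩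
            ⟨r, hj, hQ⟩
          obtain ⟨C, hC | hC, hCQ⟩ := hQ
          · exact absurd hA₀ (h.not_mixed i r hj r₀ hi C A₀ hC)
          · exact ⟨r, hj, C, hC, hCQ⟩
      obtain ⟨hmod, hleast⟩ := (dPart_sat_iff _ _).1 (hD i r₀ hi A₀ hA₀)
      -- A D-module may define several components, and the induction controls only those below the
      -- present one. So the competitor equals `U` on this component alone and keeps `I` on the
      -- other defined predicates.
      let A : DefInterp M (dPart (parts i)).defd := fun Q => if scc Q.1 then U Q.1 else I Q.1
      have hAU : ∀ Q, scc Q → compose I A Q = U Q := fun Q hQ =>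
        (compose_of_mem I A (hdef Q hQ)).trans (if_pos hQ)
      have hAI : ∀ Q, ¬ scc Q → compose I A Q = I Q := fun Q hQ => by
        by_cases hd : Q ∈ (dPart (parts i)).defd
        · exact (compose_of_mem I A hd).trans (if_neg hQ)
        · exact compose_of_notMem I A hd
      have hle : compose I A ≤ I := fun Q => by
        by_cases hQ : scc Q
        · rw [hAU Q hQ]; exact hUI Q
        · rw [hAI Q hQ]
      have key := hleast A ?_ ⟨A₀.pred, hdef _ (Or.inl rfl)⟩
      · simpa [A, scc, restrict] using key
      · intro r hr C hC s hb
        have hbI := hb.mono hle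
        by_cases hs : scc C.pred
        · unfold Atom.Holds
          rw [hAU _ hs]
          -- Closedness of `U` needs the positive body atoms in `U`: those in the component are
          -- there by the choice of `A`, the others are strictly lower and fall under the induction
          -- hypothesis.
          refine hU r (sub i r hr) s C (Or.inl hC) ⟨fun b hbp => ?_, hb.2⟩
          have hbA := hb.1 b hbp
          have hbI := hbI.1 b hbp
          cases b with
          | eq _ _ => exact hbI
          | pred B =>
            have hBA : B.val s ∈ compose I A B.pred := hbA
            by_cases hB : scc B.pred
            · rw [hAU _ hB] at hBA
              exact hBA
            · have hedge : PosDepends Prog C.pred B.pred :=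
                .single ⟨r, sub i r hr, CoreRule.hasHead_normal hC, B, hbp, rfl⟩
              have hdep : PosDepends Prog A₀.pred B.pred := by
                rcases hs with hs | hs
                · rwa [← hs]
                · exact hs.1.trans hedge
              exact ih B.pred ⟨hdep, fun hd' => hB (Or.inr ⟨hdep, hd'⟩)⟩ hbI
        · unfold Atom.Holds
          rw [hAI _ hs]
          exact hmod r hr C hC s hbI

end Splitting

end ASPFO

theorem mainTheorem1 {L : FirstOrder.Language.{u, v}}
    [Finite (ASPFO.Fun L)] [Finite (ASPFO.Pred L)]
    (Prog : ASPFO.CoreProgram L) {n : ℕ} (parts : Fin n → ASPFO.CoreProgram L)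
    (hparts : ASPFO.IsProperSplitting Prog parts)
    (M : Type w) [Nonempty M] [L.Structure M] :
    ASPFO.IsAnswerSet M Prog ↔ (ASPFO.splitTheory Prog parts).Models M := by
  rw [ASPFO.splitTheory_models_iff, ASPFO.IsAnswerSet, ASPFO.IsGeneralAnswerSet,
    ASPFO.satSM_tilde_iff]
  refine and_congr_right fun _ => ?_
  simp only [ASPFO.models_hat_iff]
  constructor
  · rintro ⟨hI, hmin⟩
    refine ⟨fun i r hr => ⟨fun A hA => hparts.gPart_sat_of_stable hI hmin hr hA,
      fun A _ => hparts.dPart_sat_of_stable hI hmin i, fun hc s hb => ?_⟩,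
      fun P hP => ASPFO.empty_of_stable hI hmin hP⟩
    exact (hI r ((hparts.cover r).2 ⟨i, hr⟩) s hb).2 hc
  · rintro ⟨hm, hE⟩
    refine ⟨fun r hr s hb => ?_, fun U hUI hU => hparts.le_of_isClosed hE
      (fun i r hr => (hm i r hr).1) (fun i r hr => (hm i r hr).2.1) hUI hU⟩
    obtain ⟨i, hi⟩ := (hparts.cover r).1 hr
    -- Choice rules are classically vacuous, so only normal rules and constraints have to be
    -- checked.
    exact ⟨fun A hA => ((ASPFO.dPart_sat_iff _ _).1 ((hm i r hi).2.1 A hA)).1 r hi A hA s hb,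
      fun hc => (hm i r hi).2.2 hc s hb⟩
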